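/- Consider the age-of-information scheduling problem under classical ARQ with packet error probability $p\in(0,1)$. It is the Markov decision process with states $\delta\in\{1,2,\dots\}$ (the age), initial state $\delta=1$ and actions $\mathrm{i}$ (stay idle) and $\mathrm{n}$ (transmit a new update): under $\mathrm{i}$ the age $\delta$ becomes $\delta+1$; under $\mathrm{n}$ it becomes $\delta+1$ with probability $p$ and $1$ with probability $1-p$. Let $\eta>0$ be the cost of a transmission (the Lagrange multiplier), and let \[ L^*_\eta=\inf_\pi L^\pi_\eta,\qquad L_\eta^\pi=\limsup_{T\to\infty}\frac1T\,\mathbb E\Big[\sum_{t=1}^{T}\big(\delta_t^\pi+\eta\,\mathbf 1[a_t^\pi\ne \mathrm{i}]\big)\Big], \] the infimum being over all history-dependent randomized policies. For $h:\{1,2,\dots\}\to\mathbb R$ put \[ Q(\delta,\mathrm{i})=\delta+h(\delta+1),\qquad Q(\delta,\mathrm{n})=\delta+\eta+p\,h(\delta+1)+(1-p)\,h(1). \] The Bellman optimality equations are $h(\delta)+L^*_\eta=\min\{Q(\delta,\mathrm{i}),Q(\delta,\mathrm{n})\}$ for all $\delta\ge1$. A stationary (possibly randomized) policy satisfies them,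 with a solution $h$, if in each state $\delta$ it chooses with probability one an action that minimizes $Q(\delta,\cdot)$. Then there is an integer $\Delta_\eta\ge1$, depending only on $p$ and $\eta$, such that the following hold. 1. $L^*_\eta$ is finite and is attained by the threshold policy with threshold $\Delta_\eta$, which takes the action $\mathrm{n}$ if $\delta\ge\Delta_\eta$ and $\mathrm{i}$ if $\delta<\Delta_\eta$; and the Bellman optimality equations have a solution $h$. 2. For every solution $h$ of the Bellman optimality equations: (a) $h$ is nondecreasing, and $Q$ is submodular: $Q(\delta^1,\mathrm{n})-Q(\delta^1,\mathrm{i})\ge Q(\delta^2,\mathrm{n})-Q(\delta^2,\mathrm{i})$ whenever $\delta^1\le\delta^2$; (b) the threshold policy with threshold $\Delta_\eta$ satisfies the Bellman optimality equations; (c) every deterministic stationary policy that satisfies the Bellman optimality equations is the threshold policy with threshold $\Delta_\eta$ or the one with threshold $\Delta_\eta+1$; (d) every stationary policy, deterministic or randomized, that satisfies the Bellman optimality equations takes the action $\mathrm{i}$ with probability one if $\delta<\Delta_\eta$ and the action $\mathrm{n}$ with probability one if $\delta>\Delta_\eta$; so it is deterministic of threshold type, except that it may take either action, or randomize, at the single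 age $\delta=\Delta_\eta$ when the two actions tie there. -/

import Mathlib

/-! Age-of-information scheduling under classical ARQ: the Markov decision process with states
`δ ∈ {1, 2, …}` (the age at the beginning of a slot), two actions, packet error probability `p`
and cost `η` per transmission. -/

namespace ARQ

/-- In each slot the source either stays idle or transmits a new status update. -/
inductive Action : Type
  | idle : Action
  | new : Action

/-- Outcome of a transmission: `true` (failure) with probability `p`, `false` (success) with
probability `1 - p`. -/
noncomputable def channel (p : unitInterval) : PMF Bool :=
  PMF.ofFintype
    (fun b => if b then ENNReal.ofReal (p : ℝ) else ENNReal.ofReal (1 - (p : ℝ)))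
    (by
      rw [Fintype.sum_bool]
      simp only [if_true, Bool.false_eq_true, if_false]
      rw [← ENNReal.ofReal_add p.2.1 (sub_nonneg.2 p.2.2)]
      simp)

/-- Law of the next age: an idle slot or a failed transmission increases the age by one, a
successful transmission resets it to one. -/
noncomputable def stepLaw (p : unitInterval) (δ : ℕ+) : Action → PMF ℕ+
  | Action.idle => PMF.pure (δ + 1)
  | Action.new => (channel p).map (fun failed => if failed then δ + 1 else 1)

/-- Expenditure of a slot: `η` for a transmission, nothing for an idle slot. -/
def txCost (η : ℝ) : Action → ℝ
  | Action.idle => 0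
  | Action.new => η

/-- Instantaneous Lagrangian cost: age plus transmission cost. -/
def stageCost (η : ℝ) (δ : ℕ+) (a : Action) : ℝ :=
  (δ : ℕ) + txCost η a

/-- The past state-action pairs, the most recent one first. -/
abbrev History : Type := List (ℕ+ × Action)

/-- A general policy: history dependent and randomized. It maps the past state-action pairs and
the current state to a distribution over the actions; the time index is the length of the
history. -/
abbrev Policy : Type := History → ℕ+ → PMF Action

/-- A stationary, possibly randomized, policy. -/
abbrev StationaryPolicy : Type := ℕ+ → PMF Action

/-- The general policy that applies a stationary policy in every slot. -/
def StationaryPolicy.toPolicy (ρ : StationaryPolicy) : Policy := fun _ δ => ρ δ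

/-- A stationary deterministic policy, as a stationary policy. -/
noncomputable def deterministic (f : ℕ+ → Action) : StationaryPolicy := fun δ => PMF.pure (f δ)

/-- Joint law of the history before slot `t` and of the age in slot `t` (slots are numbered from
`0`), under policy `π` and starting with age one. -/
noncomputable def stateLaw (p : unitInterval) (π : Policy) : ℕ → PMF (History × ℕ+)
  | 0 => PMF.pure ([], 1)
  | t + 1 => (stateLaw p π t).bind fun x =>
      (π x.1 x.2).bind fun a =>
        (stepLaw p x.2 a).map fun δ' => ((x.2, a) :: x.1, δ')

/-- Law of the age and the action in slot `t`. -/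
noncomputable def stateActionLaw (p : unitInterval) (π : Policy) (t : ℕ) : PMF (ℕ+ × Action) :=
  (stateLaw p π t).bind fun x => (π x.1 x.2).map fun a => (x.2, a)

/-- Expected Lagrangian cost of slot `t`, an extended nonnegative number (costs are nonnegative
for `η ≥ 0`). -/
noncomputable def expCost (p : unitInterval) (η : ℝ) (π : Policy) (t : ℕ) : ENNReal :=
  ∑' x : ℕ+ × Action, stateActionLaw p π t x * ENNReal.ofReal (stageCost η x.1 x.2)

/-- Infinite-horizon average Lagrangian cost of a policy. -/
noncomputable def avgCost (p : unitInterval) (η : ℝ) (π : Policy) : ENNReal :=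
  Filter.limsup (fun T : ℕ => (∑ t ∈ Finset.range T, expCost p η π t) / (T : ENNReal))
    Filter.atTop

/-- The optimal achievable average Lagrangian cost, over all policies. -/
noncomputable def optCost (p : unitInterval) (η : ℝ) : ENNReal := ⨅ π : Policy, avgCost p η π

/-- State-action cost function belonging to `h`. -/
def Q (p : unitInterval) (η : ℝ) (h : ℕ+ → ℝ) (δ : ℕ+) : Action → ℝ
  | Action.idle => (δ : ℕ) + h (δ + 1)
  | Action.new => (δ : ℕ) + η + (p : ℝ) * h (δ + 1) + (1 - (p : ℝ)) * h 1

/-- `h` is a differential cost function: it solves the Bellman optimality equations. -/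
def IsDifferentialCost (p : unitInterval) (η : ℝ) (h : ℕ+ → ℝ) : Prop :=
  ∀ δ : ℕ+, h δ + (optCost p η).toReal = min (Q p η h δ Action.idle) (Q p η h δ Action.new)

/-- A stationary policy satisfies the Bellman optimality equations with `h` if in every state it
only takes actions that minimize `Q`. -/
def SatisfiesBellman (p : unitInterval) (η : ℝ) (h : ℕ+ → ℝ) (ρ : StationaryPolicy) : Prop :=
  ∀ δ : ℕ+, ∀ a ∈ (ρ δ).support, ∀ b : Action, Q p η h δ a ≤ Q p η h δ b

/-- The threshold policy: transmit iff the age is at least `Δ`. -/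
def threshold (Δ : ℕ+) (δ : ℕ+) : Action := if Δ ≤ δ then Action.new else Action.idle

end ARQ

/-! Suppose `h ≥ 0` with `h 1 = 0` solves the Bellman equations with a constant `g` in place of the
optimal cost. Summing them along any policy gives `T g ≤ ∑ cost + E h(δ_T)`, with equality for a
policy that always minimizes `Q`. Dropping `h ≥ 0` bounds the cost of that policy by `g`. For the
lower bound, linear growth of `h` gives `E h(δ_T) ≤ K · E cost_T`, which `le_limsup_average` absorbs
even though no policy is assumed to keep this term `o(T)`. Hence the optimal cost is `g`.

Such a pair is explicit (`exists_bellman_solution`), and `bellman_unique` shows that every other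
solution is a translate of it. So `Q(δ,n) - Q(δ,i) = η - (1-p) h₀(δ+1)` for every solution. This is
positive below `Δ`, nonpositive at `Δ` and negative above, so only `Δ` can tie. -/

namespace ARQ

open scoped ENNReal

/-- Expectation of an extended nonnegative function under a probability mass function. -/
noncomputable def expect {α : Type*} (μ : PMF α) (f : α → ℝ≥0∞) : ℝ≥0∞ := ∑' x, μ x * f x

/-! ### Expectation calculus in `ℝ≥0∞` -/

section Expect

variable {α β : Type*}

theorem expect_pure (a : α) (f : α → ℝ≥0∞) : expect (PMF.pure a) f = f a := by
  classical
  unfold expect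
  rw [tsum_eq_single a]
  · simp
  · intro b hb
    simp [PMF.pure_apply, hb]

theorem expect_bind (μ : PMF α) (k : α → PMF β) (f : β → ℝ≥0∞) :
    expect (μ.bind k) f = expect μ fun a => expect (k a) f := by
  simp only [expect, PMF.bind_apply, ← ENNReal.tsum_mul_right, ← ENNReal.tsum_mul_left]
  rw [ENNReal.tsum_comm]
  simp only [mul_assoc]

theorem expect_map (μ : PMF α) (g : α → β) (f : β → ℝ≥0∞) :
    expect (μ.map g) f = expect μ fun a => f (g a) := by
  rw [← PMF.bind_pure_comp, expect_bind]
  simp [expect_pure]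

theorem expect_add (μ : PMF α) (f g : α → ℝ≥0∞) :
    (expect μ fun a => f a + g a) = expect μ f + expect μ g := by
  simp only [expect, mul_add, ENNReal.tsum_add]

theorem expect_const (μ : PMF α) (c : ℝ≥0∞) : (expect μ fun _ => c) = c := by
  simp [expect, ENNReal.tsum_mul_right, PMF.tsum_coe]

theorem expect_const_mul (μ : PMF α) (c : ℝ≥0∞) (f : α → ℝ≥0∞) :
    (expect μ fun a => c * f a) = c * expect μ f := by
  simp only [expect, ← ENNReal.tsum_mul_left]
  exact tsum_congr fun x => by ring

theorem expect_mono (μ : PMF α) {f g : α → ℝ≥0∞} (h : ∀ a, f a ≤ g a) :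
    expect μ f ≤ expect μ g :=
  ENNReal.tsum_le_tsum fun a => by gcongr; exact h a

end Expect

/-! ### One-step cost and value identities -/

theorem expCost_eq (p : unitInterval) (η : ℝ) (π : Policy) (t : ℕ) :
    expCost p η π t = expect (stateLaw p π t) fun x =>
      expect (π x.1 x.2) fun a => ENNReal.ofReal (stageCost η x.2 a) := by
  change expect (stateActionLaw p π t) _ = _
  simp only [stateActionLaw, expect_bind, expect_map]

/-- Expectation of `h` at the age of slot `t`. -/
noncomputable def expValue (p : unitInterval) (h : ℕ+ → ℝ) (π : Policy) (t : ℕ) : ℝ≥0∞ :=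
  expect (stateLaw p π t) fun x => ENNReal.ofReal (h x.2)

theorem expValue_succ (p : unitInterval) (h : ℕ+ → ℝ) (π : Policy) (t : ℕ) :
    expValue p h π (t + 1) = expect (stateLaw p π t) fun x =>
      expect (π x.1 x.2) fun a =>
        expect (stepLaw p x.2 a) fun δ => ENNReal.ofReal (h δ) := by
  simp only [expValue, stateLaw, expect_bind, expect_map]

/-- Nonnegativity of `h` lets the real-valued `Q` be read as an extended nonnegative expectation, so
no integrability has to be checked for arbitrary policies. -/
theorem stageCost_add_expect_stepLaw (p : unitInterval) {η : ℝ} (hη : 0 ≤ η) {h : ℕ+ → ℝ}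
    (hh : ∀ δ, 0 ≤ h δ) (δ : ℕ+) (a : Action) :
    (ENNReal.ofReal (stageCost η δ a) + expect (stepLaw p δ a) fun δ' => ENNReal.ofReal (h δ')) =
      ENNReal.ofReal (Q p η h δ a) := by
  have hp := p.2.1
  have hp' : 0 ≤ 1 - (p : ℝ) := sub_nonneg.2 p.2.2
  cases a with
  | idle =>
    simp only [stepLaw, expect_pure, stageCost, txCost, Q, add_zero]
    rw [ENNReal.ofReal_add (by positivity) (hh _)]
  | new =>
    simp only [stepLaw, expect_map, stageCost, txCost, Q]
    have : (expect (channel p) fun b => ENNReal.ofReal (h (if b then δ + 1 else 1))) =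
        ENNReal.ofReal (p * h (δ + 1)) + ENNReal.ofReal ((1 - p) * h 1) := by
      rw [ENNReal.ofReal_mul hp, ENNReal.ofReal_mul hp']
      simp [expect, channel]
    rw [this, ← ENNReal.ofReal_add (mul_nonneg hp (hh _)) (mul_nonneg hp' (hh _)),
      ← ENNReal.ofReal_add (by positivity)
        (add_nonneg (mul_nonneg hp (hh _)) (mul_nonneg hp' (hh _)))]
    congr 1
    ring

/-! ### Verification: a Bellman pair bounds the average cost -/

section Verification

variable {p : unitInterval} {η g : ℝ} {h : ℕ+ → ℝ}

theorem expCost_add_expValue_succ (hη : 0 ≤ η) (hh : ∀ δ, 0 ≤ h δ) (π : Policy) (t : ℕ) :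
    expCost p η π t + expValue p h π (t + 1) = expect (stateLaw p π t) fun x =>
      expect (π x.1 x.2) fun a => ENNReal.ofReal (Q p η h x.2 a) := by
  simp only [expCost_eq, expValue_succ, ← expect_add, stageCost_add_expect_stepLaw p hη hh]

theorem expValue_zero (h1 : h 1 = 0) (π : Policy) : expValue p h π 0 = 0 := by
  simp [expValue, stateLaw, expect_pure, h1]

theorem expValue_add_const (hh : ∀ δ, 0 ≤ h δ) (hg : 0 ≤ g) (π : Policy) (t : ℕ) :
    expValue p h π t + ENNReal.ofReal g =
      expect (stateLaw p π t) fun x => ENNReal.ofReal (h x.2 + g) := by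
  simp only [ENNReal.ofReal_add (hh _) hg, expect_add, expect_const, expValue]

/-- Telescoping of the Bellman inequality; the terminal value stays on the right because it may be
infinite. -/
theorem mul_le_sum_expCost (hη : 0 ≤ η) (hg : 0 ≤ g) (hh : ∀ δ, 0 ≤ h δ)
    (hQ : ∀ δ a, h δ + g ≤ Q p η h δ a) (π : Policy) (T : ℕ) :
    (T : ℝ≥0∞) * ENNReal.ofReal g ≤
      (∑ t ∈ Finset.range T, expCost p η π t) + expValue p h π T := by
  induction T with
  | zero => simp
  | succ T ih =>
    have step : expValue p h π T + ENNReal.ofReal g ≤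
        expCost p η π T + expValue p h π (T + 1) := by
      rw [expCost_add_expValue_succ hη hh, expValue_add_const hh hg]
      refine expect_mono _ fun x => ?_
      rw [← expect_const (π x.1 x.2) (ENNReal.ofReal (h x.2 + g))]
      exact expect_mono _ fun a => ENNReal.ofReal_le_ofReal (hQ _ _)
    rw [Finset.sum_range_succ, Nat.cast_succ, add_mul, one_mul]
    calc _ ≤ (∑ t ∈ Finset.range T, expCost p η π t) + expValue p h π T + ENNReal.ofReal g := by
          gcongr
      _ ≤ (∑ t ∈ Finset.range T, expCost p η π t) +
          (expCost p η π T + expValue p h π (T + 1)) := by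
          rw [add_assoc]
          gcongr
      _ = _ := by rw [add_assoc]

theorem sum_expCost_deterministic (hη : 0 ≤ η) (hg : 0 ≤ g) (hh : ∀ δ, 0 ≤ h δ) (h1 : h 1 = 0)
    {f : ℕ+ → Action} (hQ : ∀ δ, h δ + g = Q p η h δ (f δ)) (T : ℕ) :
    (∑ t ∈ Finset.range T, expCost p η (deterministic f).toPolicy t) +
      expValue p h (deterministic f).toPolicy T = (T : ℝ≥0∞) * ENNReal.ofReal g := by
  induction T with
  | zero => simp [expValue_zero h1]
  | succ T ih =>
    have step : expCost p η (deterministic f).toPolicy T +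
        expValue p h (deterministic f).toPolicy (T + 1) =
        expValue p h (deterministic f).toPolicy T + ENNReal.ofReal g := by
      rw [expCost_add_expValue_succ hη hh, expValue_add_const hh hg]
      simp only [StationaryPolicy.toPolicy, deterministic, expect_pure, hQ]
    rw [Finset.sum_range_succ, add_assoc, step, ← add_assoc, ih, Nat.cast_succ, add_mul, one_mul]

theorem avgCost_deterministic_le (hη : 0 ≤ η) (hg : 0 ≤ g) (hh : ∀ δ, 0 ≤ h δ) (h1 : h 1 = 0)
    {f : ℕ+ → Action} (hQ : ∀ δ, h δ + g = Q p η h δ (f δ)) :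
    avgCost p η (deterministic f).toPolicy ≤ ENNReal.ofReal g := by
  refine Filter.limsup_le_of_le (by isBoundedDefault) (Filter.Eventually.of_forall fun T => ?_)
  refine ENNReal.div_le_of_le_mul ?_
  rw [mul_comm, ← sum_expCost_deterministic hη hg hh h1 hQ T]
  exact le_self_add

/-- The age is itself part of the stage cost, so a linearly growing `h` is controlled by the cost of
the same slot. This replaces a growth condition on the policy. -/
theorem expValue_le_mul_expCost (hη : 0 ≤ η) {K : ℝ} (hK : 0 ≤ K)
    (hh : ∀ δ : ℕ+, h δ ≤ K * (δ : ℕ)) (π : Policy) (t : ℕ) :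
    expValue p h π t ≤ ENNReal.ofReal K * expCost p η π t := by
  rw [expCost_eq, ← expect_const_mul]
  refine expect_mono _ fun x => ?_
  rw [← expect_const_mul, ← expect_const (π x.1 x.2) (ENNReal.ofReal (h x.2))]
  refine expect_mono _ fun a => ?_
  rw [← ENNReal.ofReal_mul hK]
  refine ENNReal.ofReal_le_ofReal ((hh _).trans (mul_le_mul_of_nonneg_left ?_ hK))
  cases a <;> simp [stageCost, txCost, hη]

/-- A nonnegative sequence of stage costs whose partial sums dominate `g T` up to a multiple of the
current stage cost has upper average at least `g`. -/
theorem le_limsup_average {c : ℕ → ℝ≥0∞} {g K : ℝ} (hK : 0 < K)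
    (hc : ∀ T : ℕ, (T : ℝ≥0∞) * ENNReal.ofReal g ≤
      (∑ t ∈ Finset.range T, c t) + ENNReal.ofReal K * c T) :
    ENNReal.ofReal g ≤
      Filter.limsup (fun T : ℕ => (∑ t ∈ Finset.range T, c t) / (T : ℝ≥0∞)) Filter.atTop := by
  by_contra! hlt
  obtain ⟨b, hb, hbg⟩ := exists_between hlt
  have hbtop : b ≠ ⊤ := (hbg.trans ENNReal.ofReal_lt_top).ne
  have hev := Filter.eventually_lt_of_limsup_lt hb
  obtain ⟨T₀, hT₀⟩ := Filter.eventually_atTop.1 hev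
  have hS : ∀ T ≥ T₀ + 1, ∑ t ∈ Finset.range T, c t ≤ b * T := fun T hT =>
    (ENNReal.div_le_iff (by simp; omega) (by simp)).1 (hT₀ T (by omega)).le
  -- Each term lies in a later partial sum that is bounded by `b T`, so the rest of the argument can
  -- be carried out in `ℝ`.
  have hfin : ∀ T, c T ≠ ⊤ := fun T => by
    refine ne_top_of_le_ne_top (ENNReal.mul_ne_top hbtop (ENNReal.natCast_ne_top (T + T₀ + 1)))
      (le_trans ?_ (hS (T + T₀ + 1) (by omega)))
    exact Finset.single_le_sum (f := c) (fun _ _ => zero_le) (Finset.mem_range.2 (by omega))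
  set r : ℕ → ℝ := fun t => (c t).toReal
  have hcr : ∀ t, c t = ENNReal.ofReal (r t) := fun t => (ENNReal.ofReal_toReal (hfin t)).symm
  have hr0 : ∀ t, 0 ≤ r t := fun t => ENNReal.toReal_nonneg
  have hsum : ∀ T, ∑ t ∈ Finset.range T, c t = ENNReal.ofReal (∑ t ∈ Finset.range T, r t) := by
    intro T
    rw [ENNReal.ofReal_sum_of_nonneg fun t _ => hr0 t]
    exact Finset.sum_congr rfl fun t _ => hcr t
  have hs0 : ∀ T, 0 ≤ ∑ t ∈ Finset.range T, r t := fun T => Finset.sum_nonneg fun t _ => hr0 t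
  set β := b.toReal
  have hβ0 : 0 ≤ β := ENNReal.toReal_nonneg
  have hbβ : b = ENNReal.ofReal β := (ENNReal.ofReal_toReal hbtop).symm
  have hβg : β < g := (ENNReal.lt_ofReal_iff_toReal_lt hbtop).1 hbg
  have hS' : ∀ T ≥ T₀ + 1, ∑ t ∈ Finset.range T, r t ≤ β * T := fun T hT => by
    have := hS T hT
    rwa [hsum, hbβ, ← ENNReal.ofReal_natCast, ← ENNReal.ofReal_mul hβ0,
      ENNReal.ofReal_le_ofReal_iff (by positivity)] at this
  have hc' : ∀ T : ℕ, T * g ≤ (∑ t ∈ Finset.range T, r t) + K * r T := fun T => by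
    have := hc T
    rwa [hsum, hcr, ← ENNReal.ofReal_natCast, ← ENNReal.ofReal_mul (by positivity),
      ← ENNReal.ofReal_mul hK.le, ← ENNReal.ofReal_add (hs0 T) (mul_nonneg hK.le (hr0 T)),
      ENNReal.ofReal_le_ofReal_iff (add_nonneg (hs0 T) (mul_nonneg hK.le (hr0 T)))] at this
  -- If the averages stay below `β < g`, then `K r T ≥ T (g - β)`. From `N` on this forces `r T ≥ β
  -- + 1`, so the partial sums outgrow `β T`.
  obtain ⟨N, hN⟩ := exists_nat_ge (K * (β + 1) / (g - β))
  rw [div_le_iff₀ (sub_pos.2 hβg)] at hN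
  set M := max N (T₀ + 1)
  have hinc : ∀ T ≥ M, β + 1 ≤ r T := fun T hT => by
    have h1 := hc' T
    have h2 := hS' T (le_trans (le_max_right _ _) hT)
    have h3 : (N : ℝ) ≤ T := Nat.cast_le.2 (le_trans (le_max_left _ _) hT)
    have h4 : (N : ℝ) * (g - β) ≤ T * (g - β) :=
      mul_le_mul_of_nonneg_right h3 (sub_pos.2 hβg).le
    exact le_of_mul_le_mul_left (by linarith) hK
  have hgrow : ∀ k : ℕ, k * (β + 1) ≤ ∑ t ∈ Finset.range (M + k), r t := by
    intro k
    induction k with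
    | zero => simpa using hs0 M
    | succ k ih =>
      rw [← add_assoc, Finset.sum_range_succ]
      push_cast
      linarith [hinc (M + k) (by omega)]
  obtain ⟨k, hk⟩ := exists_nat_gt (β * M)
  have h1 := hgrow k
  have h2 := hS' (M + k) (le_trans (le_max_right _ _) (Nat.le_add_right _ _))
  push_cast at h2
  linarith

theorem le_avgCost (hη : 0 ≤ η) (hg : 0 ≤ g) (hh : ∀ δ, 0 ≤ h δ)
    (hQ : ∀ δ a, h δ + g ≤ Q p η h δ a) {K : ℝ} (hK : 0 < K)
    (hhK : ∀ δ : ℕ+, h δ ≤ K * (δ : ℕ)) (π : Policy) :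
    ENNReal.ofReal g ≤ avgCost p η π :=
  le_limsup_average hK fun T => (mul_le_sum_expCost hη hg hh hQ π T).trans <| by
    gcongr
    exact expValue_le_mul_expCost hη hK.le hhK π T

end Verification

/-! ### Uniqueness and explicit solution of the Bellman equations -/

/-- The Bellman equations with a given constant determine their solution up to an additive
constant. -/
theorem bellman_unique {p : unitInterval} (hp0 : 0 < (p : ℝ)) {η g : ℝ} {h h' : ℕ+ → ℝ}
    (H : ∀ δ, h δ + g = min (Q p η h δ Action.idle) (Q p η h δ Action.new))
    (H' : ∀ δ, h' δ + g = min (Q p η h' δ Action.idle) (Q p η h' δ Action.new)) (δ : ℕ+) :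
    h' δ - h' 1 = h δ - h 1 := by
  induction δ using PNat.recOn with
  | one => simp
  | succ n ih =>
    have e := H n
    have e' := H' n
    simp only [Q] at e e'
    -- Since `p > 0`, both branches of the minimum increase strictly with `h (n + 1)`. The action
    -- optimal for the larger solution would make the minimum for the smaller one too small.
    rcases lt_trichotomy (h' (n + 1) - h' 1) (h (n + 1) - h 1) with hlt | heq | hgt
    · exfalso
      have := mul_lt_mul_of_pos_left hlt hp0
      rcases min_choice ((n : ℕ) + h (n + 1))
        ((n : ℕ) + η + (p : ℝ) * h (n + 1) + (1 - (p : ℝ)) * h 1) with hm | hm <;>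
      rw [hm] at e
      · have := min_le_left ((n : ℕ) + h' (n + 1))
          ((n : ℕ) + η + (p : ℝ) * h' (n + 1) + (1 - (p : ℝ)) * h' 1)
        linarith
      · have := min_le_right ((n : ℕ) + h' (n + 1))
          ((n : ℕ) + η + (p : ℝ) * h' (n + 1) + (1 - (p : ℝ)) * h' 1)
        linarith
    · exact heq
    · exfalso
      have := mul_lt_mul_of_pos_left hgt hp0
      rcases min_choice ((n : ℕ) + h' (n + 1))
        ((n : ℕ) + η + (p : ℝ) * h' (n + 1) + (1 - (p : ℝ)) * h' 1) with hm | hm <;>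
      rw [hm] at e'
      · have := min_le_left ((n : ℕ) + h (n + 1))
          ((n : ℕ) + η + (p : ℝ) * h (n + 1) + (1 - (p : ℝ)) * h 1)
        linarith
      · have := min_le_right ((n : ℕ) + h (n + 1))
          ((n : ℕ) + η + (p : ℝ) * h (n + 1) + (1 - (p : ℝ)) * h 1)
        linarith

/-- The optimal threshold: the least `Δ` with `F Δ < a η ≤ F (Δ + 1)`, where
`F x = (x - 1) (x - 2) / 2 + a (x - 1)`. -/
theorem exists_threshold {a η : ℝ} (ha : 1 ≤ a) (hη : 0 < η) :
    ∃ Δ : ℕ+, ((Δ : ℕ) - 1 : ℝ) * ((Δ : ℕ) - 2) / 2 + a * ((Δ : ℕ) - 1) < a * η ∧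
      a * η ≤ ((Δ : ℕ) : ℝ) * ((Δ : ℕ) - 1) / 2 + a * (Δ : ℕ) := by
  classical
  have hex : ∃ n : ℕ, a * η ≤ ((n : ℝ) + 1) * n / 2 + a * (n + 1) := by
    obtain ⟨n, hn⟩ := exists_nat_ge η
    refine ⟨n, ?_⟩
    have : a * η ≤ a * (n + 1) := mul_le_mul_of_nonneg_left (by linarith) (by linarith)
    have : (0 : ℝ) ≤ ((n : ℝ) + 1) * n / 2 := by positivity
    linarith
  refine ⟨(Nat.find hex).succPNat, ?_, ?_⟩
  · rcases Nat.eq_zero_or_eq_succ_pred (Nat.find hex) with h0 | h0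
    · rw [h0]
      simpa using mul_pos (by linarith) hη
    · have := Nat.find_min hex (m := (Nat.find hex).pred) (by omega)
      rw [h0]
      simp only [Nat.succPNat_coe, Nat.succ_eq_add_one]
      push_cast
      linarith
  · have := Nat.find_spec hex
    simp only [Nat.succPNat_coe, Nat.succ_eq_add_one]
    push_cast
    linarith

/-- An explicit solution of the Bellman equations: quadratic below the threshold, affine above. -/
theorem exists_bellman_solution {p : unitInterval} (hp0 : 0 < (p : ℝ)) (hp1 : (p : ℝ) < 1) {η : ℝ}
    (hη : 0 < η) :
    ∃ (Δ : ℕ+) (g : ℝ) (h : ℕ+ → ℝ) (K : ℝ), 0 ≤ g ∧ 0 < K ∧ h 1 = 0 ∧ Monotone h ∧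
      (∀ δ : ℕ+, h δ ≤ K * (δ : ℕ)) ∧
      (∀ δ, h δ + g = min (Q p η h δ Action.idle) (Q p η h δ Action.new)) ∧
      (1 - (p : ℝ)) * h Δ < η ∧ η ≤ (1 - (p : ℝ)) * h (Δ + 1) ∧ h (Δ + 1) < h (Δ + 1 + 1) := by
  have hq : 0 < 1 - (p : ℝ) := sub_pos.2 hp1
  obtain ⟨a, haq⟩ : ∃ a : ℝ, (1 - (p : ℝ)) * a = 1 := ⟨_, mul_inv_cancel₀ hq.ne'⟩
  have ha1 : 1 ≤ a := by
    by_contra! hlt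
    nlinarith
  obtain ⟨Δ, hlow, hup⟩ := exists_threshold ha1 hη
  have hΔ1 : (1 : ℝ) ≤ (Δ : ℕ) := by exact_mod_cast Δ.2
  set x : ℝ := ((Δ : ℕ) : ℝ)
  have hD : 0 < x - 1 + a := by linarith
  -- With `a = 1 / (1 - p)`, this choice of `g` makes the quadratic and affine formulas for `h`
  -- agree at `Δ`. The two inequalities on `Δ` then become `x - 1 + a < g ≤ x + a`.
  obtain ⟨g, hg⟩ : ∃ g : ℝ, g * (x - 1 + a) = x * (x - 1) / 2 + a * x + a * η + a * (a - 1) :=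
    ⟨_, div_mul_cancel₀ _ hD.ne'⟩
  have hg1 : x - 1 + a < g := by
    refine lt_of_mul_lt_mul_right ?_ hD.le
    rw [hg]
    linarith
  have hg2 : g ≤ x + a := by
    refine le_of_mul_le_mul_right ?_ hD
    rw [hg]
    linarith
  -- Idling below `Δ` forces increments `g - δ`; transmitting from `Δ` on is solved by slope `a`,
  -- with intercept fixed by `p a = a - 1`.
  set h : ℕ+ → ℝ := fun δ =>
    if δ ≤ Δ then g * ((δ : ℕ) - 1) - ((δ : ℕ) : ℝ) * ((δ : ℕ) - 1) / 2
    else a * ((δ : ℕ) + η + (a - 1) - g) with hh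
  have h_low : ∀ δ : ℕ+, δ ≤ Δ →
      h δ = g * ((δ : ℕ) - 1) - ((δ : ℕ) : ℝ) * ((δ : ℕ) - 1) / 2 := fun δ hδ => by
    simp [hh, hδ]
  have h_high : ∀ δ : ℕ+, Δ ≤ δ → h δ = a * ((δ : ℕ) + η + (a - 1) - g) := fun δ hδ => by
    rcases hδ.eq_or_lt with rfl | hlt
    · rw [h_low _ le_rfl]
      linarith
    · simp [hh, not_le.2 hlt]
  have h_succ_low : ∀ δ : ℕ+, δ < Δ → h (δ + 1) = h δ + g - (δ : ℕ) := fun δ hδ => by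
    rw [h_low δ hδ.le, h_low (δ + 1) (PNat.add_one_le_iff.2 hδ)]
    push_cast
    ring
  have h_succ_high : ∀ δ : ℕ+, Δ ≤ δ → h (δ + 1) = h δ + a := fun δ hδ => by
    rw [h_high δ hδ, h_high (δ + 1) (hδ.trans (PNat.lt_add_right δ 1).le)]
    push_cast
    ring
  have h_step : ∀ δ : ℕ+, h δ ≤ h (δ + 1) := fun δ => by
    rcases lt_or_ge δ Δ with hδ | hδ
    · rw [h_succ_low δ hδ]
      have : ((δ : ℕ) : ℝ) ≤ x := Nat.cast_le.2 (PNat.coe_le_coe _ _ |>.2 hδ.le)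
      linarith
    · rw [h_succ_high δ hδ]
      linarith
  have h_mono : Monotone h := fun m n hmn => by
    induction n using PNat.recOn with
    | one => rw [le_antisymm hmn (one_le (a := m))]
    | succ n ih =>
      rcases hmn.eq_or_lt with rfl | hlt
      · exact le_rfl
      · exact (ih (PNat.lt_add_one_iff.1 hlt)).trans (h_step n)
  have h_one : h 1 = 0 := by simp [h_low 1 (one_le (a := Δ))]
  have h_thr : (1 - (p : ℝ)) * h Δ < η := by
    rw [h_high Δ le_rfl, ← mul_assoc, haq]
    linarith
  have h_thr' : η ≤ (1 - (p : ℝ)) * h (Δ + 1) := by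
    rw [h_high (Δ + 1) (PNat.lt_add_right Δ 1).le, ← mul_assoc, haq]
    push_cast
    linarith
  refine ⟨Δ, g, h, g + a, by linarith, by linarith, h_one, h_mono, fun δ => ?_, fun δ => ?_,
    h_thr, h_thr', ?_⟩
  · induction δ using PNat.recOn with
    | one => rw [h_one]; simp; linarith
    | succ n ih =>
      push_cast
      have : (0 : ℝ) ≤ (n : ℕ) := Nat.cast_nonneg _
      rcases lt_or_ge n Δ with hδ | hδ
      · rw [h_succ_low n hδ]
        linarith
      · rw [h_succ_high n hδ]
        linarith
  · simp only [Q, h_one]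
    rcases lt_or_ge δ Δ with hδ | hδ
    · have := mul_le_mul_of_nonneg_left (h_mono (PNat.add_one_le_iff.2 hδ)) hq.le
      rw [min_eq_left (by linarith), h_succ_low δ hδ]
      ring
    · have := mul_le_mul_of_nonneg_left (h_mono (add_le_add_left hδ 1)) hq.le
      rw [min_eq_right (by linarith), h_succ_high δ hδ, h_high δ hδ]
      linear_combination ((δ : ℕ) + η + a - g) * haq
  · rw [h_succ_high (Δ + 1) (PNat.lt_add_right Δ 1).le]
    linarith

/-! ### From minimizing actions to policies -/

theorem pmf_eq_pure_idle {μ : PMF Action} (h : Action.new ∉ μ.support) :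
    μ = PMF.pure Action.idle := by
  have hs : μ.support = {Action.idle} := by
    obtain ⟨b, hb⟩ := μ.support_nonempty
    ext a
    cases a <;> cases b <;> simp_all
  have h1 : μ Action.idle = 1 := (μ.apply_eq_one_iff _).2 hs
  ext a
  cases a
  · simp [h1]
  · simpa [PMF.pure_apply] using h

theorem pmf_eq_pure_new {μ : PMF Action} (h : Action.idle ∉ μ.support) :
    μ = PMF.pure Action.new := by
  have hs : μ.support = {Action.new} := by
    obtain ⟨b, hb⟩ := μ.support_nonempty
    ext a
    cases a <;> cases b <;> simp_all
  have h1 : μ Action.new = 1 := (μ.apply_eq_one_iff _).2 hs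
  ext a
  cases a
  · simpa [PMF.pure_apply] using h
  · simp [h1]

end ARQ

theorem mainTheorem3 (p : unitInterval) (hp0 : 0 < p) (hp1 : p < 1) (η : ℝ) (hη : 0 < η) :
    ∃ Δ : ℕ+,
      -- the optimal average cost is finite and is attained by the threshold policy
      ARQ.optCost p η ≠ ⊤ ∧
      ARQ.avgCost p η (ARQ.deterministic (ARQ.threshold Δ)).toPolicy = ARQ.optCost p η ∧
      -- the Bellman optimality equations have a solution
      (∃ h : ℕ+ → ℝ, ARQ.IsDifferentialCost p η h) ∧
      ∀ h : ℕ+ → ℝ, ARQ.IsDifferentialCost p η h →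
        -- monotonicity of `h` and submodularity of `Q`
        Monotone h ∧
        (∀ δ₁ δ₂ : ℕ+, δ₁ ≤ δ₂ →
          ARQ.Q p η h δ₂ ARQ.Action.new - ARQ.Q p η h δ₂ ARQ.Action.idle ≤
            ARQ.Q p η h δ₁ ARQ.Action.new - ARQ.Q p η h δ₁ ARQ.Action.idle) ∧
        -- the threshold policy satisfies the Bellman equations
        ARQ.SatisfiesBellman p η h (ARQ.deterministic (ARQ.threshold Δ)) ∧
        -- every deterministic policy that satisfies them is a threshold policy
        (∀ f : ℕ+ → ARQ.Action, ARQ.SatisfiesBellman p η h (ARQ.deterministic f) →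
          f = ARQ.threshold Δ ∨ f = ARQ.threshold (Δ + 1)) ∧
        -- every stationary policy that satisfies them is deterministic with this threshold,
        -- except possibly at the age `Δ`
        (∀ ρ : ARQ.StationaryPolicy, ARQ.SatisfiesBellman p η h ρ →
          ∀ δ : ℕ+, (δ < Δ → ρ δ = PMF.pure ARQ.Action.idle) ∧
            (Δ < δ → ρ δ = PMF.pure ARQ.Action.new)) := by
  have hp0' : 0 < (p : ℝ) := hp0
  have hp1' : (p : ℝ) < 1 := hp1
  have hq : 0 < 1 - (p : ℝ) := sub_pos.2 hp1'
  obtain ⟨Δ, g, h₀, K, hg, hK, h1, hmono, hle, hB, hlow, hup, hstrict⟩ :=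
    ARQ.exists_bellman_solution hp0' hp1' hη
  have hnn : ∀ δ, 0 ≤ h₀ δ := fun δ => h1 ▸ hmono (one_le (a := δ))
  have hQle : ∀ δ a, h₀ δ + g ≤ ARQ.Q p η h₀ δ a := fun δ a => by
    rw [hB δ]
    cases a
    · exact min_le_left _ _
    · exact min_le_right _ _
  have hidle : ∀ δ, δ < Δ → (1 - (p : ℝ)) * h₀ (δ + 1) < η := fun δ hδ =>
    (mul_le_mul_of_nonneg_left (hmono (PNat.add_one_le_iff.2 hδ)) hq.le).trans_lt hlow
  have hnew : ∀ δ, Δ ≤ δ → η ≤ (1 - (p : ℝ)) * h₀ (δ + 1) := fun δ hδ =>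
    hup.trans (mul_le_mul_of_nonneg_left (hmono (add_le_add_left hδ 1)) hq.le)
  -- `hup` may be an equality, which is the tie at `Δ`; the strict increase of `h₀` from `Δ + 1` to
  -- `Δ + 2` excludes ties beyond it.
  have hnew' : ∀ δ, Δ < δ → η < (1 - (p : ℝ)) * h₀ (δ + 1) := fun δ hδ =>
    (hup.trans_lt (mul_lt_mul_of_pos_left hstrict hq)).trans_le
      (mul_le_mul_of_nonneg_left (hmono (add_le_add_left (PNat.add_one_le_iff.2 hδ) 1)) hq.le)
  have hthr : ∀ δ, h₀ δ + g = ARQ.Q p η h₀ δ (ARQ.threshold Δ δ) := fun δ => by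
    rw [hB δ]
    unfold ARQ.threshold
    split_ifs with hδ
    · refine min_eq_right ?_
      simp only [ARQ.Q, h1]
      linarith [hnew δ hδ]
    · refine min_eq_left ?_
      simp only [ARQ.Q, h1]
      linarith [hidle δ (not_le.1 hδ)]
  have havg := ARQ.avgCost_deterministic_le hη.le hg hnn h1 hthr
  have hopt_ge : ENNReal.ofReal g ≤ ARQ.optCost p η :=
    le_iInf fun π => ARQ.le_avgCost hη.le hg hnn hQle hK hle π
  have hopt_le : ARQ.optCost p η ≤
      ARQ.avgCost p η (ARQ.deterministic (ARQ.threshold Δ)).toPolicy := iInf_le _ _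
  have hopt : ARQ.optCost p η = ENNReal.ofReal g := le_antisymm (hopt_le.trans havg) hopt_ge
  have hreal : (ARQ.optCost p η).toReal = g := by rw [hopt, ENNReal.toReal_ofReal hg]
  refine ⟨Δ, hopt ▸ ENNReal.ofReal_ne_top, le_antisymm (havg.trans hopt_ge) hopt_le,
    ⟨h₀, fun δ => by rw [hreal]; exact hB δ⟩, fun h hh => ?_⟩
  -- Once the optimal cost is known to be `g`, uniqueness reduces an arbitrary solution to `h₀`; the
  -- additive constant cancels in differences of `Q`.
  have hshift : ∀ δ, h δ = h₀ δ + h 1 := fun δ => by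
    have := ARQ.bellman_unique hp0' hB (fun δ => hreal ▸ hh δ) δ
    linarith
  have hdiff : ∀ δ, ARQ.Q p η h δ ARQ.Action.new - ARQ.Q p η h δ ARQ.Action.idle =
      η - (1 - (p : ℝ)) * h₀ (δ + 1) := fun δ => by
    simp only [ARQ.Q, hshift (δ + 1)]
    ring
  have hran : ∀ ρ : ARQ.StationaryPolicy, ARQ.SatisfiesBellman p η h ρ →
      ∀ δ : ℕ+, (δ < Δ → ρ δ = PMF.pure ARQ.Action.idle) ∧
        (Δ < δ → ρ δ = PMF.pure ARQ.Action.new) := by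
    refine fun ρ hρ δ => ⟨fun hδ => ARQ.pmf_eq_pure_idle fun hs => ?_,
      fun hδ => ARQ.pmf_eq_pure_new fun hs => ?_⟩
    · linarith [hρ δ _ hs ARQ.Action.idle, hdiff δ, hidle δ hδ]
    · linarith [hρ δ _ hs ARQ.Action.new, hdiff δ, hnew' δ hδ]
  refine ⟨fun δ₁ δ₂ hδ => ?_, fun δ₁ δ₂ hδ => ?_, fun δ a ha b => ?_, fun f hf => ?_, hran⟩
  · rw [hshift δ₁, hshift δ₂]
    linarith [hmono hδ]
  · rw [hdiff, hdiff]
    linarith [mul_le_mul_of_nonneg_left (hmono (add_le_add_left hδ 1)) hq.le]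
  · obtain rfl : a = ARQ.threshold Δ δ := by simpa [ARQ.deterministic] using ha
    have hd := hdiff δ
    unfold ARQ.threshold
    split_ifs with hδ
    · have := hnew δ hδ
      cases b <;> linarith
    · have := hidle δ (not_le.1 hδ)
      cases b <;> linarith
  · have hpure : ∀ {a b : ARQ.Action}, PMF.pure a = PMF.pure b → a = b := fun {a b} hab => by
      have : a ∈ (PMF.pure b).support := hab ▸ by simp
      simpa using this
    have hlt : ∀ δ, δ < Δ → f δ = ARQ.Action.idle := fun δ hδ => hpure ((hran _ hf δ).1 hδ)
    have hgt : ∀ δ, Δ < δ → f δ = ARQ.Action.new := fun δ hδ => hpure ((hran _ hf δ).2 hδ)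
    cases hΔ : f Δ with
    | new =>
      left
      funext δ
      rcases lt_trichotomy δ Δ with hδ | rfl | hδ
      · simp [ARQ.threshold, hlt δ hδ, hδ]
      · simp [ARQ.threshold, hΔ]
      · simp [ARQ.threshold, hgt δ hδ, hδ.le]
    | idle =>
      right
      funext δ
      rcases lt_trichotomy δ Δ with hδ | rfl | hδ
      · simp [ARQ.threshold, hlt δ hδ, hδ.le]
      · simp [ARQ.threshold, hΔ]
      · simp [ARQ.threshold, hgt δ hδ, hδ]
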